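/- **Theorem (Discrete Jacobi asymptotics).** *Notation.* Let $0\le q<1$, $\alpha=\frac{2q}{1-q}$ and $\phi(z)=\dfrac{1}{1+\alpha(1-z)+\frac{\alpha^2}{2}(1-z)}$. For $a=\pm\frac12$ and $s\in\mathbb N=\{0,1,2,\dots\}$ let $J_{s,a}$ be the polynomials determined by $$J_{s,1/2}\Big(\tfrac{z+z^{-1}}{2}\Big)=\frac{z^{s+1}-z^{-(s+1)}}{z-z^{-1}},\qquad J_{s,-1/2}\Big(\tfrac{z+z^{-1}}{2}\Big)=\frac{z^{s+1/2}+z^{-(s+1/2)}}{z^{1/2}+z^{-1/2}}.$$ For a level $k$ put $a_k=-\frac12$ if $k$ is odd, $a_k=\frac12$ if $k$ is even, and $r_k=\lfloor\frac{k+1}{2}\rfloor$. For $T\in\mathbb N$ the correlation kernel is $$\begin{aligned}K_T((s,k),(s',m))=\;&\frac{2^{a_k+1/2}}{\pi}\,\frac{1}{2\pi i}\int_{-1}^1\oint\frac{\phi(x)^T}{\phi(u)^T}J_{s,a_k}(x)J_{s',a_m}(u)\frac{(1-x)^{r_k}}{(1-u)^{r_m}}\frac{(1-x)^{a_k}(1+x)^{1/2}}{x-u}\,du\,dx\\&+1_{k\ge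 m}\frac{2^{a_k+1/2}}{\pi}\int_{-1}^1J_{s,a_k}(x)J_{s',a_m}(x)(1-x)^{r_k-r_m+a_k}(1+x)^{1/2}\,dx,\end{aligned}$$ where the $u$-contour is a positively oriented simple loop around $[-1,1]$ and $1/\phi(u)^T$ is read as the polynomial $\big(1+\alpha(1-u)+\tfrac{\alpha^2}{2}(1-u)\big)^T$. For $-1<u<1$ the discrete Jacobi kernel is $$L(r_1,a_1,s_1,r_2,a_2,s_2,b;u)=\begin{cases}\displaystyle\frac{2^{a_1+1/2}}{\pi}\int_u^1J_{s_1,a_1}(x)J_{s_2,a_2}(x)(x-1)^{r_1-r_2}(1-x)^{a_1}(1+x)^b\,dx,&2r_1+a_1\ge 2r_2+a_2,\\[2mm]\displaystyle-\frac{2^{a_1+1/2}}{\pi}\int_{-1}^uJ_{s_1,a_1}(x)J_{s_2,a_2}(x)(x-1)^{r_1-r_2}(1-x)^{a_1}(1+x)^b\,dx,&2r_1+a_1<2r_2+a_2,\end{cases}$$ which depends on $r_1,r_2$ only through $r_1-r_2$. *Statement.* Let $t,l>0$ and let $T=T(N)\in\mathbb N$ satisfy $T/N\to t$ as $N\to\infty$.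 Let $n\in\mathbb N$, let $s_1,\dots,s_n\in\mathbb N$ and $a_1,\dots,a_n\in\{\pm\frac12\}$ be fixed, and let $r_1,\dots,r_n\in\mathbb N$ depend on $N$ in such a way that $r_i/N\to l$ while all differences $r_i-r_j$ are independent of $N$. Suppose that $k_i=2r_i+a_i-\frac12\in\mathbb N$. 1. If $l\ge(1-(1+\alpha)^{-2})\,t$ and the points $(s_1,k_1),\dots,(s_n,k_n)$ are pairwise distinct, then $$\lim_{N\to\infty}\det\big[K_T((s_i,k_i),(s_j,k_j))\big]_{i,j=1}^n=1.$$ 2. If $l<(1-(1+\alpha)^{-2})\,t$, then, with $\theta=1+\dfrac{2l}{(l-t)(2\alpha+\alpha^2)}$, $$\lim_{N\to\infty}\det\big[K_T((s_i,k_i),(s_j,k_j))\big]_{i,j=1}^n=\det\big[L(r_i,a_i,s_i,r_j,a_j,s_j,\tfrac12;\theta)\big]_{i,j=1}^n.$$ -/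

import Mathlib

namespace DiscreteJacobi

noncomputable section

/-- The parameter `a_k`: it is `-1/2` on odd levels and `1/2` on even levels. -/
def levelParam (k : ℕ) : ℝ := if Odd k then -(1 / 2) else 1 / 2

/-- The number `r_k = ⌊(k + 1) / 2⌋` of particles on level `k`. -/
def levelRank (k : ℕ) : ℕ := (k + 1) / 2

/-- The Jacobi polynomials `J_{s,a}`, `a = ±1/2`, normalized as in `jacobi_pos` and `jacobi_neg`
below. (Only the two values `a = 1/2` and `a = -1/2` are ever used.) -/
def jacobi (s : ℕ) (a : ℝ) : Polynomial ℝ :=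
  if a = 1 / 2 then Polynomial.Chebyshev.U ℝ s
  else Polynomial.Chebyshev.U ℝ s - Polynomial.Chebyshev.U ℝ ((s : ℤ) - 1)

/-- `φ(z) = 1 / (1 + α (1 - z) + (α² / 2) (1 - z))`. -/
def phi (α : ℝ) (z : ℂ) : ℂ :=
  1 / (1 + (α : ℂ) * (1 - z) + (α : ℂ) ^ 2 / 2 * (1 - z))

/-- The correlation kernel `K_T((s,k),(t,m))`. The `u`-contour is a positively oriented simple loop
around `[-1, 1]`. Since `1 / φ(u) ^ T` is a polynomial, the only singularities in `u` are `u = x`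
and `u = 1`, so all such loops give the same value; the circle `|u| = 2` is used. -/
def kernelK (α : ℝ) (T : ℕ) (p p' : ℕ × ℕ) : ℂ :=
  (((2 : ℝ) ^ (levelParam p.2 + 1 / 2) / Real.pi : ℝ) : ℂ) * (1 / (2 * Real.pi * Complex.I)) *
      (∫ x in (-1 : ℝ)..1, ∮ u in C(0, 2),
        phi α x ^ T / phi α u ^ T
          * Polynomial.aeval (x : ℂ) (jacobi p.1 (levelParam p.2))
          * Polynomial.aeval u (jacobi p'.1 (levelParam p'.2))
          * ((1 - (x : ℂ)) ^ levelRank p.2 / (1 - u) ^ levelRank p'.2)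
          * ((((1 - x) ^ levelParam p.2 * (1 + x) ^ (1 / 2 : ℝ) : ℝ) : ℂ) / ((x : ℂ) - u)))
    + if p'.2 ≤ p.2 then
        (((2 : ℝ) ^ (levelParam p.2 + 1 / 2) / Real.pi *
          ∫ x in (-1 : ℝ)..1,
            (jacobi p.1 (levelParam p.2)).eval x * (jacobi p'.1 (levelParam p'.2)).eval x
              * (1 - x) ^ ((levelRank p.2 : ℝ) - levelRank p'.2 + levelParam p.2)
              * (1 + x) ^ (1 / 2 : ℝ) : ℝ) : ℂ)
      else 0

/-- The discrete Jacobi kernel `L(r₁, a₁, s₁, r₂, a₂, s₂, b; u)`. -/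
def kernelL (r₁ : ℤ) (a₁ : ℝ) (s₁ : ℕ) (r₂ : ℤ) (a₂ : ℝ) (s₂ : ℕ) (b u : ℝ) : ℝ :=
  if 2 * (r₁ : ℝ) + a₁ ≥ 2 * (r₂ : ℝ) + a₂ then
    (2 : ℝ) ^ (a₁ + 1 / 2) / Real.pi *
      ∫ x in u..1, (jacobi s₁ a₁).eval x * (jacobi s₂ a₂).eval x
        * (x - 1) ^ (r₁ - r₂) * (1 - x) ^ a₁ * (1 + x) ^ b
  else
    -((2 : ℝ) ^ (a₁ + 1 / 2) / Real.pi) *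
      ∫ x in (-1 : ℝ)..u, (jacobi s₁ a₁).eval x * (jacobi s₂ a₂).eval x
        * (x - 1) ^ (r₁ - r₂) * (1 - x) ^ a₁ * (1 + x) ^ b

/-- `J_{s,1/2}((z + z⁻¹)/2) = (z^{s+1} - z^{-(s+1)}) / (z - z⁻¹)`. -/
theorem jacobi_pos (s : ℕ) (z : ℂ) (hz : z ≠ 0) (hz' : z - z⁻¹ ≠ 0) :
    Polynomial.aeval ((z + z⁻¹) / 2) (jacobi s (1 / 2))
      = (z ^ (s + 1) - z⁻¹ ^ (s + 1)) / (z - z⁻¹) := by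
  have key : ∀ n : ℕ, (Polynomial.Chebyshev.U ℂ n).eval ((z + z⁻¹) / 2) * (z - z⁻¹)
      = z ^ (n + 1) - z⁻¹ ^ (n + 1) := by
    intro n
    induction n using Nat.twoStepInduction with
    | zero => simp
    | one => simp; ring
    | more n h0 h1 =>
      have := Polynomial.Chebyshev.U_add_two ℂ (n : ℤ)
      push_cast at h1 ⊢
      rw [this]
      simp only [Polynomial.eval_sub, Polynomial.eval_mul, Polynomial.eval_X,
        Polynomial.eval_ofNat]
      rw [sub_mul, h0, mul_assoc, h1]
      have hv := mul_inv_cancel₀ hz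
      generalize z⁻¹ = v at hv
      linear_combination (z ^ (n + 1) - v ^ (n + 1)) * hv
  rw [eq_div_iff hz', ← key s]
  simp [jacobi, Polynomial.Chebyshev.aeval_U]

/-- With `z = w²`:
`J_{s,-1/2}((z + z⁻¹)/2) = (z^{s+1/2} + z^{-(s+1/2)}) / (z^{1/2} + z^{-1/2})`. -/
theorem jacobi_neg (s : ℕ) (w : ℂ) (hw : w ≠ 0) (hw' : w + w⁻¹ ≠ 0) :
    Polynomial.aeval ((w ^ 2 + (w ^ 2)⁻¹) / 2) (jacobi s (-(1 / 2)))
      = (w ^ (2 * s + 1) + w⁻¹ ^ (2 * s + 1)) / (w + w⁻¹) := by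
  have key : ∀ n : ℕ, ((Polynomial.Chebyshev.U ℂ n).eval ((w ^ 2 + (w ^ 2)⁻¹) / 2)
      - (Polynomial.Chebyshev.U ℂ ((n : ℤ) - 1)).eval ((w ^ 2 + (w ^ 2)⁻¹) / 2)) * (w + w⁻¹)
      = w ^ (2 * n + 1) + w⁻¹ ^ (2 * n + 1) := by
    intro n
    induction n using Nat.twoStepInduction with
    | zero => simp
    | one => simp; field_simp; ring
    | more n h0 h1 =>
      have e1 := Polynomial.Chebyshev.U_add_two ℂ (n : ℤ)
      have e2 := Polynomial.Chebyshev.U_add_two ℂ ((n : ℤ) - 1)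
      have e3 : ((n : ℤ) - 1 + 2) = n + 1 := by ring
      have e4 : ((n : ℤ) - 1 + 1) = n := by ring
      have e5 : ((n : ℤ) + 2 - 1) = n + 1 := by ring
      have e6 : ((n : ℤ) + 1 - 1) = n := by ring
      rw [e3, e4] at e2
      push_cast at h1 ⊢
      rw [e6] at h1
      rw [e5, e1]
      nth_rewrite 2 [e2]
      simp only [Polynomial.eval_sub, Polynomial.eval_mul, Polynomial.eval_X,
        Polynomial.eval_ofNat]
      have : w ^ (2 * (n + 2) + 1) + w⁻¹ ^ (2 * (n + 2) + 1)
          = (w ^ 2 + (w ^ 2)⁻¹) * (w ^ (2 * (n + 1) + 1) + w⁻¹ ^ (2 * (n + 1) + 1))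
            - (w ^ (2 * n + 1) + w⁻¹ ^ (2 * n + 1)) := by
        have hv := mul_inv_cancel₀ hw
        rw [← inv_pow]
        generalize w⁻¹ = v at hv
        linear_combination (-(w * v + 1) * (w ^ (2 * n + 1) + v ^ (2 * n + 1))) * hv
      rw [this, ← h0, ← h1]
      ring
  rw [eq_div_iff hw', ← key s]
  have : ¬ (-(1 / 2) : ℝ) = 1 / 2 := by norm_num
  simp only [jacobi, if_neg this, map_sub, Polynomial.Chebyshev.aeval_U]

end

end DiscreteJacobi

/-! With `b = α + α² / 2` one has `1 / φ(u) = 1 + b (1 - u)`. Expand `φ(u)^(-T) J_{s'}(u)` in powers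
of `1 - u`. Integrating against `1 / ((1 - u)^m (x - u))` keeps exactly the terms of degree at least
`m`, evaluated at `x`: below that degree the residues at `x` and at `1` cancel. After multiplication
by `φ(x)^T`, each coefficient of `J_{s'}` carries a binomial tail with `T` trials and odds `z = b (1
- x)` (`circleIntegral_kernel`, `kernelK_eq`).

By Chebyshev's inequality this tail tends to `1` or `0` according as `t z / (1 + z)` is above or
below `l`. The two sides agree at `x = θ`; in the first regime the tail vanishes on all of `(-1,
1)`. To pass to the limit under the integral, a singular factor `(1 - x)^(r - r')` must be
controlled near `x = 1`; `exists_binomTail_le_pow` bounds the tail by any fixed power of `z`,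
uniformly in large `N` (`tendsto_integral_truncEval`).

In the second regime the limit is `L` up to the sign `(-1)^(r - r')`, a diagonal conjugation
invisible to the determinant. In the first only the single-integral term survives; ordered by level,
the limit matrix is block triangular, with identity blocks by orthonormality. -/

namespace DiscreteJacobi

/-! ### Orthonormality of the Jacobi polynomials. -/

open Polynomial.Chebyshev in
theorem two_mul_one_sub_sq_mul_U_mul_U (x : ℝ) (hx : x ∈ Set.Ioo (-1 : ℝ) 1) (s t : ℤ) :
    2 * (1 - x ^ 2) * ((U ℝ s).eval x * (U ℝ t).eval x)
      = (T ℝ (s - t)).eval x - (T ℝ (s + t + 2)).eval x := by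
  obtain ⟨φ, rfl⟩ : ∃ φ, x = Real.cos φ :=
    ⟨Real.arccos x, (Real.cos_arccos hx.1.le hx.2.le).symm⟩
  have h1 := U_real_cos φ s
  have h2 := U_real_cos φ t
  have h3 : 1 - Real.cos φ ^ 2 = Real.sin φ ^ 2 := by
    linarith [Real.sin_sq_add_cos_sq φ]
  rw [T_real_cos, T_real_cos, h3]
  have e1 : (((s - t : ℤ) : ℝ)) * φ = (s + 1) * φ - (t + 1) * φ := by push_cast; ring
  have e2 : (((s + t + 2 : ℤ) : ℝ)) * φ = (s + 1) * φ + (t + 1) * φ := by push_cast; ring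
  rw [e1, e2, Real.cos_sub, Real.cos_add, ← h1, ← h2]
  ring

-- Expanding the differences gives four instances of the previous identity; the three-term
-- recurrence of `T` then produces a common factor `2 (1 - x)`, which cancels.
open Polynomial.Chebyshev in
theorem one_add_mul_V_mul_V (x : ℝ) (hx : x ∈ Set.Ioo (-1 : ℝ) 1) (s t : ℤ) :
    (1 + x) * ((U ℝ s - U ℝ (s - 1)).eval x * (U ℝ t - U ℝ (t - 1)).eval x)
      = (T ℝ (s - t)).eval x + (T ℝ (s + t + 1)).eval x := by
  have h1 := two_mul_one_sub_sq_mul_U_mul_U x hx s t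
  have h2 := two_mul_one_sub_sq_mul_U_mul_U x hx (s - 1) t
  have h3 := two_mul_one_sub_sq_mul_U_mul_U x hx s (t - 1)
  have h4 := two_mul_one_sub_sq_mul_U_mul_U x hx (s - 1) (t - 1)
  have h5 := congrArg (Polynomial.eval x) (T_add_two ℝ (s - t - 1))
  have h6 := congrArg (Polynomial.eval x) (T_add_two ℝ (s + t))
  rw [show s - 1 - t = s - t - 1 by ring, show s - 1 + t + 2 = s + t + 1 by ring] at h2
  rw [show s - (t - 1) = s - t - 1 + 2 by ring, show s + (t - 1) + 2 = s + t + 1 by ring] at h3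
  rw [show s - 1 - (t - 1) = s - t by ring, show s - 1 + (t - 1) + 2 = s + t by ring] at h4
  rw [show s - t - 1 + 1 = s - t by ring] at h5
  simp only [Polynomial.eval_sub, Polynomial.eval_mul, Polynomial.eval_ofNat,
    Polynomial.eval_X] at h5 h6 ⊢
  have h7 : (2 * (1 - x)) ≠ 0 := by have := hx.2; exact (by linarith : 0 < 2 * (1 - x)).ne'
  apply mul_left_cancel₀ h7
  linear_combination h1 - h2 - h3 + h4 - h5 - h6

open Polynomial.Chebyshev in
theorem integral_eval_T_mul_sqrt (n : ℤ) :
    ∫ x in (-1 : ℝ)..1, (T ℝ n).eval x * √(1 - x ^ 2)⁻¹ = if n = 0 then Real.pi else 0 := by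
  rw [← integral_measureT]
  split_ifs with h
  · rw [h, integral_eval_T_real_measureT_zero]
  · exact integral_eval_T_real_measureT_of_ne_zero h

open Polynomial.Chebyshev in
theorem intervalIntegrable_eval_T_mul_sqrt (n : ℤ) :
    IntervalIntegrable (fun x => (T ℝ n).eval x * √(1 - x ^ 2)⁻¹) MeasureTheory.volume (-1) 1 :=
  intervalIntegrable_sqrt_one_sub_sq_inv.continuousOn_mul (by fun_prop)

/-- The polynomials `J_{s,a}` are orthonormal for their weight. -/
theorem integral_jacobi_mul_jacobi (s t : ℕ) (a : ℝ) (ha : a = 1 / 2 ∨ a = -(1 / 2)) :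
    (2 : ℝ) ^ (a + 1 / 2) / Real.pi * ∫ x in (-1 : ℝ)..1,
      (jacobi s a).eval x * (jacobi t a).eval x * (1 - x) ^ a * (1 + x) ^ (1 / 2 : ℝ)
      = if s = t then 1 else 0 := by
  have hpi := Real.pi_ne_zero
  have hst : ((s : ℤ) - t = 0) ↔ s = t := by omega
  have hsq : ∀ x ∈ Set.Ioo (-1 : ℝ) 1,
      √(1 - x ^ 2)⁻¹ = ((1 - x) ^ (1 / 2 : ℝ))⁻¹ * ((1 + x) ^ (1 / 2 : ℝ))⁻¹ := by
    intro x hx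
    have h1 : 0 ≤ 1 - x := by linarith [hx.2]
    rw [show 1 - x ^ 2 = (1 - x) * (1 + x) by ring, Real.sqrt_inv, Real.sqrt_mul h1,
      Real.sqrt_eq_rpow, Real.sqrt_eq_rpow, mul_inv]
  have hhalf : ∀ y : ℝ, 0 < y → (y ^ (1 / 2 : ℝ)) * y ^ (1 / 2 : ℝ) = y := by
    intro y hy
    rw [← Real.rpow_add hy]; norm_num
  rcases ha with rfl | rfl
  · have : ∫ x in (-1 : ℝ)..1, (jacobi s (1 / 2)).eval x * (jacobi t (1 / 2)).eval x
          * (1 - x) ^ (1 / 2 : ℝ) * (1 + x) ^ (1 / 2 : ℝ)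
        = ∫ x in (-1 : ℝ)..1, (1 / 2 : ℝ) *
          ((Polynomial.Chebyshev.T ℝ (s - t)).eval x * √(1 - x ^ 2)⁻¹
            - (Polynomial.Chebyshev.T ℝ (s + t + 2)).eval x * √(1 - x ^ 2)⁻¹) := by
      refine intervalIntegral.integral_congr_Ioo_of_le (by norm_num) fun x hx => ?_
      have h := two_mul_one_sub_sq_mul_U_mul_U x hx s t
      have h1 : 0 < 1 - x := by linarith [hx.2]
      have h2 : 0 < 1 + x := by linarith [hx.1]
      simp only [jacobi, if_true]
      rw [← sub_mul, ← h, hsq x hx]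
      have e1 := hhalf _ h1
      have e2 := hhalf _ h2
      have p1 := (Real.rpow_pos_of_pos h1 (1 / 2)).ne'
      have p2 := (Real.rpow_pos_of_pos h2 (1 / 2)).ne'
      rw [show 1 - x ^ 2 = (1 - x) * (1 + x) by ring]
      generalize (1 - x) ^ (1 / 2 : ℝ) = c at *
      generalize (1 + x) ^ (1 / 2 : ℝ) = d at *
      rw [← e1, ← e2]
      field_simp
    rw [this, intervalIntegral.integral_const_mul,
      intervalIntegral.integral_sub (intervalIntegrable_eval_T_mul_sqrt _)
        (intervalIntegrable_eval_T_mul_sqrt _), integral_eval_T_mul_sqrt,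
      integral_eval_T_mul_sqrt, if_neg (by omega : ¬ ((s : ℤ) + t + 2 = 0))]
    simp only [hst]
    split_ifs <;> norm_num
    field_simp
  · have : ∫ x in (-1 : ℝ)..1, (jacobi s (-(1 / 2))).eval x * (jacobi t (-(1 / 2))).eval x
          * (1 - x) ^ (-(1 / 2) : ℝ) * (1 + x) ^ (1 / 2 : ℝ)
        = ∫ x in (-1 : ℝ)..1,
          ((Polynomial.Chebyshev.T ℝ (s - t)).eval x * √(1 - x ^ 2)⁻¹
            + (Polynomial.Chebyshev.T ℝ (s + t + 1)).eval x * √(1 - x ^ 2)⁻¹) := by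
      refine intervalIntegral.integral_congr_Ioo_of_le (by norm_num) fun x hx => ?_
      have h := one_add_mul_V_mul_V x hx s t
      have h1 : 0 < 1 - x := by linarith [hx.2]
      have h2 : 0 < 1 + x := by linarith [hx.1]
      have hne : ¬ (-(1 / 2) : ℝ) = 1 / 2 := by norm_num
      simp only [jacobi, if_neg hne]
      rw [← add_mul, ← h, hsq x hx, Real.rpow_neg h1.le]
      have e2 := hhalf _ h2
      have p2 := (Real.rpow_pos_of_pos h2 (1 / 2)).ne'
      generalize (1 - x) ^ (1 / 2 : ℝ) = c at *
      generalize (1 + x) ^ (1 / 2 : ℝ) = d at *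
      rw [← e2]
      field_simp
    rw [this, intervalIntegral.integral_add (intervalIntegrable_eval_T_mul_sqrt _)
        (intervalIntegrable_eval_T_mul_sqrt _), integral_eval_T_mul_sqrt,
      integral_eval_T_mul_sqrt, if_neg (by omega : ¬ ((s : ℤ) + t + 1 = 0))]
    simp only [hst]
    split_ifs <;> norm_num

/-! ### Contour integrals over the circle of radius two. -/

theorem sphere_sub_ne_zero {u w : ℂ} (hu : u ∈ Metric.sphere (0 : ℂ) 2) (hw : ‖w‖ < 2) :
    w - u ≠ 0 := by
  intro h
  rw [mem_sphere_zero_iff_norm, ← sub_eq_zero.mp h] at hu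
  exact hw.ne hu

theorem circleIntegral_pow_div (w : ℂ) (hw : ‖w‖ < 2) (n : ℕ) :
    (∮ u in C(0, 2), (1 - u) ^ n / (w - u)) = -(2 * Real.pi * Complex.I) * (1 - w) ^ n := by
  have h := Complex.circleIntegral_sub_inv_smul_of_differentiable_on_off_countable
    (R := 2) (c := 0) (w := w) (f := fun u : ℂ => (1 - u) ^ n) Set.countable_empty
    (by simpa using hw) (by fun_prop) (fun x _ => by fun_prop)
  have e : ∀ u : ℂ, (1 - u) ^ n / (w - u) = -1 * ((u - w)⁻¹ • (1 - u) ^ n) := by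
    intro u
    rw [smul_eq_mul, ← neg_sub u w, div_neg, div_eq_inv_mul, neg_one_mul]
  simp only [e]
  rw [circleIntegral.integral_const_mul, h, smul_eq_mul, neg_mul, neg_mul, one_mul]

theorem circleIntegral_inv_pow_add_two (n : ℕ) :
    (∮ u in C(0, 2), ((1 - u) ^ (n + 2))⁻¹) = 0 := by
  have h := circleIntegral.integral_sub_zpow_of_ne (n := -((n : ℤ) + 2)) (by omega) 0 1 2
  have e : ∀ u : ℂ, ((1 - u) ^ (n + 2))⁻¹ = (-1) ^ (n + 2) * (u - 1) ^ (-((n : ℤ) + 2)) := by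
    intro u
    rw [zpow_neg, show ((n : ℤ) + 2) = ((n + 2 : ℕ) : ℤ) by push_cast; ring, zpow_natCast,
      ← neg_sub u 1, neg_pow, mul_inv, ← inv_pow]
    norm_num
  simp only [e]
  rw [circleIntegral.integral_const_mul, h, mul_zero]

theorem continuousOn_inv_pow_div (w : ℂ) (hw : ‖w‖ < 2) (n : ℕ) :
    ContinuousOn (fun u : ℂ => ((1 - u) ^ n)⁻¹ / (w - u)) (Metric.sphere 0 2) := by
  refine ContinuousOn.div (ContinuousOn.inv₀ (by fun_prop) fun u hu => ?_) (by fun_prop)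
    fun u hu => sphere_sub_ne_zero hu hw
  exact pow_ne_zero _ (sphere_sub_ne_zero hu (by norm_num))

/-- Both poles lie inside the circle and their residues cancel. Partial fractions lower the order of
the pole at `1` one step at a time; at the bottom two simple poles contribute equal amounts with
opposite signs. -/
theorem circleIntegral_inv_pow_succ_div (w : ℂ) (hw : ‖w‖ < 2) (hw1 : w ≠ 1) (n : ℕ) :
    (∮ u in C(0, 2), ((1 - u) ^ (n + 1))⁻¹ / (w - u)) = 0 := by
  have key : ∀ n : ℕ, (∮ u in C(0, 2), ((1 - u) ^ (n + 1))⁻¹ / (w - u))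
      = (1 - w)⁻¹ * ((∮ u in C(0, 2), ((1 - u) ^ n)⁻¹ / (w - u))
        - ∮ u in C(0, 2), ((1 - u) ^ (n + 1))⁻¹) := by
    intro n
    have hc : ContinuousOn (fun u : ℂ => ((1 - u) ^ (n + 1))⁻¹) (Metric.sphere 0 2) :=
      ContinuousOn.inv₀ (by fun_prop)
        fun u hu => pow_ne_zero _ (sphere_sub_ne_zero hu (by norm_num))
    rw [← circleIntegral.integral_sub
      ((continuousOn_inv_pow_div w hw n).circleIntegrable (by norm_num))
      (hc.circleIntegrable (by norm_num)), ← circleIntegral.integral_const_mul]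
    refine circleIntegral.integral_congr (by norm_num) fun u hu => ?_
    have h1 := sphere_sub_ne_zero (w := 1) hu (by norm_num)
    have h2 := sphere_sub_ne_zero hu hw
    have h3 : 1 - w ≠ 0 := sub_ne_zero.mpr hw1.symm
    field_simp
    ring
  induction n with
  | zero =>
    rw [key 0]
    have h0 := circleIntegral_pow_div w hw 0
    have h1 := circleIntegral_pow_div 1 (by norm_num) 0
    simp only [pow_zero, one_div, mul_one] at h0 h1
    simp only [pow_zero, inv_one, one_div, zero_add, pow_one, h0, h1, sub_self, mul_zero]
  | succ n ih => rw [key, ih, circleIntegral_inv_pow_add_two, sub_self, mul_zero]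

theorem circleIntegral_pow_div_pow_div (w : ℂ) (hw : ‖w‖ < 2) (hw1 : w ≠ 1) (j m : ℕ) :
    (∮ u in C(0, 2), (1 - u) ^ j / (1 - u) ^ m / (w - u))
      = -(2 * Real.pi * Complex.I) * (if m ≤ j then (1 - w) ^ j / (1 - w) ^ m else 0) := by
  have hw' : 1 - w ≠ 0 := sub_ne_zero.mpr hw1.symm
  split_ifs with h
  · obtain ⟨i, rfl⟩ := Nat.exists_eq_add_of_le h
    rw [pow_add, mul_div_cancel_left₀ _ (pow_ne_zero _ hw'), ← circleIntegral_pow_div w hw i]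
    refine circleIntegral.integral_congr (by norm_num) fun u hu => ?_
    have h1 := sphere_sub_ne_zero (w := 1) hu (by norm_num)
    simp only [pow_add]
    rw [mul_div_cancel_left₀ _ (pow_ne_zero _ h1)]
  · obtain ⟨i, rfl⟩ := Nat.exists_eq_add_of_lt (not_le.mp h)
    rw [mul_zero]
    refine Eq.trans ?_ (circleIntegral_inv_pow_succ_div w hw hw1 i)
    refine circleIntegral.integral_congr (by norm_num) fun u hu => ?_
    have h1 := sphere_sub_ne_zero (w := 1) hu (by norm_num)
    rw [add_assoc j i 1, pow_add _ j, div_mul_eq_div_div, div_self (pow_ne_zero _ h1), one_div]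

/-! ### Estimates for binomial tails. -/

/-- The probability that a binomial variable with `T` trials of odds `z` is at least `m`. -/
noncomputable def binomTail (T m : ℕ) (z : ℝ) : ℝ :=
  (∑ j ∈ Finset.range (T + 1), if m ≤ j then (T.choose j : ℝ) * z ^ j else 0) / (1 + z) ^ T

theorem sum_choose_mul_pow (T : ℕ) (z : ℝ) :
    ∑ j ∈ Finset.range (T + 1), (T.choose j : ℝ) * z ^ j = (1 + z) ^ T := by
  rw [add_comm 1 z, add_pow]
  simp [mul_comm]

theorem binomTail_nonneg (T m : ℕ) {z : ℝ} (hz : 0 ≤ z) : 0 ≤ binomTail T m z := by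
  refine div_nonneg (Finset.sum_nonneg fun j _ => ?_) (by positivity)
  split_ifs <;> positivity

theorem binomTail_le_one (T m : ℕ) {z : ℝ} (hz : 0 ≤ z) : binomTail T m z ≤ 1 := by
  rw [binomTail, div_le_one (by positivity), ← sum_choose_mul_pow]
  refine Finset.sum_le_sum fun j _ => ?_
  split_ifs
  · rfl
  · positivity

/-- Termwise from `(j + 1) C(T + 1, j + 1) = (T + 1) C(T, j)` with `j ≥ m`; the larger normalization
on the left only helps. -/
theorem binomTail_succ_succ_le (T m : ℕ) {z : ℝ} (hz : 0 ≤ z) :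
    binomTail (T + 1) (m + 1) z ≤ (T + 1) * z / (m + 1) * binomTail T m z := by
  have hsum : (m + 1 : ℝ) * ∑ j ∈ Finset.range (T + 1 + 1),
        (if m + 1 ≤ j then ((T + 1).choose j : ℝ) * z ^ j else 0)
      ≤ (T + 1) * z * ∑ j ∈ Finset.range (T + 1),
        (if m ≤ j then (T.choose j : ℝ) * z ^ j else 0) := by
    rw [Finset.sum_range_succ', if_neg (by omega), add_zero, Finset.mul_sum, Finset.mul_sum]
    refine Finset.sum_le_sum fun j _ => ?_
    simp only [add_le_add_iff_right]
    split_ifs with h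
    · have h1 : (T + 1 : ℝ) * T.choose j = (T + 1).choose (j + 1) * (j + 1) := by
        exact_mod_cast Nat.add_one_mul_choose_eq T j
      have h2 : (m : ℝ) ≤ j := by exact_mod_cast h
      calc (m + 1 : ℝ) * (((T + 1).choose (j + 1) : ℝ) * z ^ (j + 1))
          ≤ (j + 1) * (((T + 1).choose (j + 1) : ℝ) * z ^ (j + 1)) := by gcongr
        _ = (T + 1) * z * (T.choose j * z ^ j) := by
          rw [pow_succ]; linear_combination (-(z ^ j * z)) * h1
    · simp
  have hS : 0 ≤ (T + 1) * z * ∑ j ∈ Finset.range (T + 1),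
      (if m ≤ j then (T.choose j : ℝ) * z ^ j else 0) := by
    refine mul_nonneg (by positivity) (Finset.sum_nonneg fun j _ => ?_)
    split_ifs <;> positivity
  rw [binomTail, binomTail, div_mul_div_comm,
    div_le_div_iff₀ (by positivity) (by positivity)]
  have h1 : (1 + z) ^ T ≤ (1 + z) ^ (T + 1) := pow_le_pow_right₀ (by linarith) (by omega)
  calc _ = ((m + 1 : ℝ) * ∑ j ∈ Finset.range (T + 1 + 1),
        (if m + 1 ≤ j then ((T + 1).choose j : ℝ) * z ^ j else 0)) * (1 + z) ^ T := by ring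
    _ ≤ _ := mul_le_mul hsum h1 (by positivity) hS

/-- Iterating the previous bound gives denominators `m, m - 1, ..., m + 1 - d`, all replaced by the
smallest. -/
theorem binomTail_le_pow (d : ℕ) {z : ℝ} (hz : 0 ≤ z) :
    ∀ T m : ℕ, d ≤ m → binomTail T m z ≤ ((T : ℝ) * z / (m + 1 - d)) ^ d := by
  induction d with
  | zero => intro T m _; simpa using binomTail_le_one T m hz
  | succ d ih =>
    intro T m hm
    obtain ⟨m, rfl⟩ : ∃ m', m = m' + 1 := ⟨m - 1, by omega⟩
    have hdm : (d : ℝ) ≤ m := by exact_mod_cast (by omega : d ≤ m)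
    rcases T with _ | T
    · simp [binomTail]
    · have h1 := ih T m (by omega)
      have hpos : (0 : ℝ) < m + 1 - d := by linarith
      push_cast
      rw [show (m + 1 + 1 - (d + 1) : ℝ) = m + 1 - d by ring, pow_succ']
      refine (binomTail_succ_succ_le T m hz).trans ?_
      refine mul_le_mul ?_ (h1.trans ?_) (binomTail_nonneg T m hz) (by positivity)
      · gcongr
        linarith
      · gcongr
        linarith

/-- This is the binomial variance `T p (1 - p) ≤ T` at `p = z / (1 + z)`, with denominators cleared.
-/
theorem sum_sq_mul_choose_mul_pow (T : ℕ) {z : ℝ} (hz : 0 ≤ z) :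
    ∑ j ∈ Finset.range (T + 1), (T * (z / (1 + z)) - j) ^ 2 * ((T.choose j : ℝ) * z ^ j)
      ≤ T * (1 + z) ^ T := by
  have hz1 : 0 < 1 + z := by linarith
  have h := congrArg (Polynomial.eval (z / (1 + z))) (bernsteinPolynomial.variance ℝ T)
  simp only [Polynomial.eval_finsetSum, bernsteinPolynomial, Polynomial.eval_mul,
    Polynomial.eval_pow, Polynomial.eval_sub, Polynomial.eval_X, Polynomial.eval_natCast,
    Polynomial.eval_one, nsmul_eq_mul] at h
  have h1 : 1 - z / (1 + z) = 1 / (1 + z) := by field_simp; ring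
  have hp : z / (1 + z) ≤ 1 := by rw [div_le_one hz1]; linarith
  have hq : 1 / (1 + z) ≤ 1 := by rw [div_le_one hz1]; linarith
  have h2 : ∑ j ∈ Finset.range (T + 1), (T * (z / (1 + z)) - j) ^ 2 * ((T.choose j : ℝ) * z ^ j)
      = T * (z / (1 + z)) * (1 / (1 + z)) * (1 + z) ^ T := by
    rw [← h1, ← h, Finset.sum_mul]
    refine Finset.sum_congr rfl fun j hj => ?_
    have hj' : j + (T - j) = T := by have := Finset.mem_range.mp hj; omega
    have e : (1 + z) ^ T = (1 + z) ^ j * (1 + z) ^ (T - j) := by rw [← pow_add, hj']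
    rw [h1, e, div_pow, div_pow, one_pow]
    field_simp
  rw [h2]
  have h3 : z / (1 + z) * (1 / (1 + z)) ≤ 1 :=
    mul_le_one₀ hp (by positivity) hq
  rw [mul_assoc (T : ℝ)]
  gcongr
  exact mul_le_of_le_one_right (by positivity) h3

/-- Chebyshev's inequality for a cutoff above the mean. -/
theorem sq_mul_binomTail_le (T m : ℕ) {z : ℝ} (hz : 0 ≤ z) (hm : T * (z / (1 + z)) < m) :
    (m - T * (z / (1 + z))) ^ 2 * binomTail T m z ≤ T := by
  have hz1 : 0 < 1 + z := by linarith
  rw [binomTail, ← mul_div_assoc, div_le_iff₀ (by positivity), Finset.mul_sum]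
  refine le_trans (Finset.sum_le_sum fun j _ => ?_) (sum_sq_mul_choose_mul_pow T hz)
  split_ifs with h
  · have : (m : ℝ) ≤ j := by exact_mod_cast h
    have h2 : (m - T * (z / (1 + z))) ^ 2 ≤ (T * (z / (1 + z)) - j) ^ 2 := by
      rw [← neg_sub (j : ℝ), neg_sq]
      exact pow_le_pow_left₀ (by linarith) (by linarith) 2
    gcongr
  · rw [mul_zero]; positivity

theorem sq_mul_one_sub_binomTail_le (T m : ℕ) {z : ℝ} (hz : 0 ≤ z)
    (hm : m < T * (z / (1 + z))) :
    (m - T * (z / (1 + z))) ^ 2 * (1 - binomTail T m z) ≤ T := by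
  have hz1 : 0 < 1 + z := by linarith
  have h1 : 1 - binomTail T m z = (∑ j ∈ Finset.range (T + 1),
      if m ≤ j then 0 else (T.choose j : ℝ) * z ^ j) / (1 + z) ^ T := by
    rw [binomTail, eq_div_iff (by positivity), sub_mul, div_mul_cancel₀ _ (by positivity), one_mul,
      ← sum_choose_mul_pow, ← Finset.sum_sub_distrib]
    refine Finset.sum_congr rfl fun j _ => ?_
    split_ifs <;> simp
  rw [h1, ← mul_div_assoc, div_le_iff₀ (by positivity), Finset.mul_sum]
  refine le_trans (Finset.sum_le_sum fun j _ => ?_) (sum_sq_mul_choose_mul_pow T hz)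
  split_ifs with h
  · rw [mul_zero]; positivity
  · have : (j : ℝ) ≤ m := by exact_mod_cast (not_le.mp h).le
    have h2 : (m - T * (z / (1 + z))) ^ 2 ≤ (T * (z / (1 + z)) - j) ^ 2 := by
      rw [← neg_sub, neg_sq]
      exact pow_le_pow_left₀ (by linarith) (by linarith) 2
    gcongr

/-! ### Limits of binomial tails. -/

section Limits

variable {t l : ℝ} {T m : ℕ → ℕ}

theorem tendsto_div_sq_deviation (p : ℝ) (h : l ≠ t * p)
    (hT : Filter.Tendsto (fun N : ℕ => (T N : ℝ) / N) Filter.atTop (nhds t))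
    (hm : Filter.Tendsto (fun N : ℕ => (m N : ℝ) / N) Filter.atTop (nhds l)) :
    Filter.Tendsto (fun N => (T N : ℝ) / (m N - T N * p) ^ 2) Filter.atTop (nhds 0) := by
  have h1 : Filter.Tendsto (fun N : ℕ => (1 : ℝ) / N * ((T N : ℝ) / N)
      / ((m N : ℝ) / N - T N / N * p) ^ 2) Filter.atTop (nhds (0 * t / (l - t * p) ^ 2)) :=
    (tendsto_one_div_atTop_nhds_zero_nat.mul hT).div ((hm.sub (hT.mul_const p)).pow 2)
      (pow_ne_zero _ (sub_ne_zero.mpr h))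
  rw [zero_mul, zero_div] at h1
  refine h1.congr' ?_
  filter_upwards [Filter.eventually_gt_atTop 0] with N hN
  have hN' : (N : ℝ) ≠ 0 := by exact_mod_cast hN.ne'
  rw [show (m N : ℝ) / N - T N / N * p = (m N - T N * p) / N by ring, div_pow]
  field_simp

theorem tendsto_binomTail_zero {z : ℝ} (hz : 0 ≤ z) (h : t * (z / (1 + z)) < l)
    (hT : Filter.Tendsto (fun N : ℕ => (T N : ℝ) / N) Filter.atTop (nhds t))
    (hm : Filter.Tendsto (fun N : ℕ => (m N : ℝ) / N) Filter.atTop (nhds l)) :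
    Filter.Tendsto (fun N => binomTail (T N) (m N) z) Filter.atTop (nhds 0) := by
  refine tendsto_of_tendsto_of_tendsto_of_le_of_le' tendsto_const_nhds
    (tendsto_div_sq_deviation (z / (1 + z)) h.ne' hT hm)
    (Filter.Eventually.of_forall fun N => binomTail_nonneg _ _ hz) ?_
  have hlt := (hT.mul_const (z / (1 + z))).eventually_lt hm h
  filter_upwards [hlt, Filter.eventually_gt_atTop 0] with N h1 hN
  have hN' : (0 : ℝ) < N := by exact_mod_cast hN
  have h2 : (T N : ℝ) * (z / (1 + z)) < m N := by
    rwa [div_mul_eq_mul_div, div_lt_div_iff_of_pos_right hN'] at h1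
  rw [le_div_iff₀ (pow_pos (by linarith) 2), mul_comm]
  exact sq_mul_binomTail_le _ _ hz h2

theorem tendsto_binomTail_one {z : ℝ} (hz : 0 ≤ z) (h : l < t * (z / (1 + z)))
    (hT : Filter.Tendsto (fun N : ℕ => (T N : ℝ) / N) Filter.atTop (nhds t))
    (hm : Filter.Tendsto (fun N : ℕ => (m N : ℝ) / N) Filter.atTop (nhds l)) :
    Filter.Tendsto (fun N => binomTail (T N) (m N) z) Filter.atTop (nhds 1) := by
  have h0 : Filter.Tendsto (fun N => 1 - binomTail (T N) (m N) z) Filter.atTop (nhds 0) := by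
    refine tendsto_of_tendsto_of_tendsto_of_le_of_le' tendsto_const_nhds
      (tendsto_div_sq_deviation (z / (1 + z)) h.ne hT hm)
      (Filter.Eventually.of_forall fun N => sub_nonneg.mpr (binomTail_le_one _ _ hz)) ?_
    have hlt := hm.eventually_lt (hT.mul_const (z / (1 + z))) h
    filter_upwards [hlt, Filter.eventually_gt_atTop 0] with N h1 hN
    have hN' : (0 : ℝ) < N := by exact_mod_cast hN
    have h2 : (m N : ℝ) < T N * (z / (1 + z)) := by
      rwa [div_mul_eq_mul_div, div_lt_div_iff_of_pos_right hN'] at h1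
    rw [le_div_iff₀ (sq_pos_iff.mpr (sub_ne_zero.mpr h2.ne)), mul_comm]
    exact sq_mul_one_sub_binomTail_le _ _ hz h2
  simpa using h0.const_sub 1

/-- The coefficient of `(1 - u)^i` lowers the cutoff by `i`; this shift does not affect the limit.
-/
theorem tendsto_natSub_div (i : ℕ)
    (hm : Filter.Tendsto (fun N : ℕ => (m N : ℝ) / N) Filter.atTop (nhds l)) :
    Filter.Tendsto (fun N : ℕ => ((m N - i : ℕ) : ℝ) / N) Filter.atTop (nhds l) := by
  have h0 : Filter.Tendsto (fun N : ℕ => (m N : ℝ) / N - i / N) Filter.atTop (nhds (l - 0)) :=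
    hm.sub (tendsto_const_div_atTop_nhds_zero_nat _)
  rw [sub_zero] at h0
  refine tendsto_of_tendsto_of_tendsto_of_le_of_le h0 hm (fun N => ?_) fun N => ?_
  · rw [← sub_div]
    gcongr
    rw [sub_le_iff_le_add]
    rw [← Nat.cast_add, Nat.cast_le]
    omega
  · dsimp only
    gcongr
    omega

/-- Up to a constant the binomial tail is bounded by any fixed power of the odds. -/
theorem exists_binomTail_le_pow (d : ℕ) (hl : 0 < l)
    (hT : Filter.Tendsto (fun N : ℕ => (T N : ℝ) / N) Filter.atTop (nhds t))
    (hm : Filter.Tendsto (fun N : ℕ => (m N : ℝ) / N) Filter.atTop (nhds l)) :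
    ∃ C : ℝ, 0 ≤ C ∧ ∀ᶠ N in Filter.atTop, ∀ z : ℝ, 0 ≤ z →
      binomTail (T N) (m N) z ≤ C * z ^ d := by
  have h1 : Filter.Tendsto (fun N : ℕ => ((T N : ℝ) / N) / ((m N : ℝ) / N - d / N))
      Filter.atTop (nhds (t / (l - 0))) :=
    hT.div (hm.sub (tendsto_const_div_atTop_nhds_zero_nat _)) (by simpa using hl.ne')
  have h2 : Filter.Tendsto (fun N : ℕ => (m N : ℝ) / N - d / N) Filter.atTop (nhds (l - 0)) :=
    hm.sub (tendsto_const_div_atTop_nhds_zero_nat _)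
  -- The ratio `T / (m - d)` tends to `t / l`; adding `1` makes the bound hold eventually.
  refine ⟨(|t / (l - 0)| + 1) ^ d, by positivity, ?_⟩
  filter_upwards [h1.eventually_lt_const (lt_of_le_of_lt (le_abs_self _) (lt_add_one _)),
    h2.eventually_const_lt (by simpa using hl : (0 : ℝ) < l - 0),
    Filter.eventually_gt_atTop 0] with N hb hpos hN z hz
  have hN' : (0 : ℝ) < N := by exact_mod_cast hN
  rw [← sub_div] at hpos hb
  have hdm : (0 : ℝ) < m N - d := by
    have := mul_pos hpos hN'
    rwa [div_mul_cancel₀ _ hN'.ne'] at this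
  rw [div_div_div_cancel_right₀ hN'.ne'] at hb
  refine (binomTail_le_pow d hz (T N) (m N) ?_).trans ?_
  · exact_mod_cast (sub_pos.mp hdm).le
  · rw [← mul_pow]
    refine pow_le_pow_left₀ (div_nonneg (by positivity) (by linarith)) ?_ d
    calc (T N : ℝ) * z / (m N + 1 - d) ≤ (T N : ℝ) * z / (m N - d) := by
          gcongr
          linarith
      _ = T N / (m N - d) * z := by ring
      _ ≤ _ := by gcongr

end Limits

/-! ### Reduction of the kernel to a real integral. -/

/-- The part of `(1 + b y) ^ T * Q(y)` of degree at least `m`, evaluated at `y = 1 - x` and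
divided by `(1 + b y) ^ T`. -/
noncomputable def truncEval (b : ℝ) (T m : ℕ) (Q : Polynomial ℝ) (x : ℝ) : ℝ :=
  ∑ i ∈ Finset.range (Q.natDegree + 1),
    Q.coeff i * (1 - x) ^ i * binomTail T (m - i) (b * (1 - x))

theorem aeval_comp_one_sub (P : Polynomial ℝ) (u : ℂ) :
    Polynomial.aeval u P = ∑ i ∈ Finset.range ((P.comp (1 - Polynomial.X)).natDegree + 1),
      ((P.comp (1 - Polynomial.X)).coeff i : ℂ) * (1 - u) ^ i := by
  have h : Polynomial.aeval u P = Polynomial.aeval (1 - u) (P.comp (1 - Polynomial.X)) := by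
    simp [Polynomial.aeval_comp]
  rw [h, Polynomial.aeval_eq_sum_range]
  simp [Algebra.smul_def]

theorem eval_comp_one_sub (P : Polynomial ℝ) (x : ℝ) :
    P.eval x = ∑ i ∈ Finset.range ((P.comp (1 - Polynomial.X)).natDegree + 1),
      (P.comp (1 - Polynomial.X)).coeff i * (1 - x) ^ i := by
  rw [← Polynomial.eval_eq_sum_range]
  simp [Polynomial.eval_comp]

theorem circleIntegral_kernel (b : ℝ) (T r m : ℕ) (P P' : Polynomial ℝ) (α W x : ℝ)
    (hb : b = α + α ^ 2 / 2) (hx : x ∈ Set.Ioo (-1 : ℝ) 1) :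
    (∮ u in C(0, 2), phi α x ^ T / phi α u ^ T * Polynomial.aeval (x : ℂ) P
        * Polynomial.aeval u P' * ((1 - (x : ℂ)) ^ r / (1 - u) ^ m) * ((W : ℂ) / ((x : ℂ) - u)))
      = -(2 * Real.pi * Complex.I) * ((P.eval x * ((1 - x) ^ r / (1 - x) ^ m * W)
          * truncEval b T m (P'.comp (1 - Polynomial.X)) x : ℝ) : ℂ) := by
  have hphi : ∀ u : ℂ, phi α u = (1 + b * (1 - u))⁻¹ := by
    intro u
    rw [phi, one_div, hb]
    push_cast
    ring_nf
  have hxn : ‖(x : ℂ)‖ < 2 := by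
    rw [Complex.norm_real, Real.norm_eq_abs, abs_lt]
    exact ⟨by linarith [hx.1], by linarith [hx.2]⟩
  have hx1 : (x : ℂ) ≠ 1 := by exact_mod_cast hx.2.ne
  set Q := P'.comp (1 - Polynomial.X) with hQ
  have hbin : ∀ u : ℂ, (1 + b * (1 - u)) ^ T
      = ∑ j ∈ Finset.range (T + 1), (T.choose j : ℂ) * b ^ j * (1 - u) ^ j := by
    intro u
    rw [add_comm, add_pow]
    refine Finset.sum_congr rfl fun j _ => ?_
    rw [mul_pow, one_pow]
    ring
  have hint : ∀ u : ℂ, phi α x ^ T / phi α u ^ T * Polynomial.aeval (x : ℂ) P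
        * Polynomial.aeval u P' * ((1 - (x : ℂ)) ^ r / (1 - u) ^ m) * ((W : ℂ) / ((x : ℂ) - u))
      = ∑ p ∈ Finset.range (Q.natDegree + 1) ×ˢ Finset.range (T + 1),
        (phi α x ^ T * Polynomial.aeval (x : ℂ) P * (1 - (x : ℂ)) ^ r * W * Q.coeff p.1
          * (T.choose p.2 * b ^ p.2)) * ((1 - u) ^ (p.1 + p.2) / (1 - u) ^ m / (x - u)) := by
    intro u
    rw [hphi u, inv_pow, div_inv_eq_mul, hbin, aeval_comp_one_sub P', ← hQ, Finset.sum_product]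
    simp only [Finset.mul_sum, Finset.sum_mul]
    refine Finset.sum_congr rfl fun i _ => Finset.sum_congr rfl fun j _ => ?_
    rw [pow_add]
    ring
  simp only [hint]
  rw [circleIntegral.integral_fun_sum]
  · simp only [circleIntegral.integral_const_mul, circleIntegral_pow_div_pow_div _ hxn hx1]
    rw [Finset.sum_product]
    simp only [truncEval, binomTail]
    push_cast
    rw [Finset.mul_sum, Finset.mul_sum]
    refine Finset.sum_congr rfl fun i _ => ?_
    rw [hphi, Finset.sum_div, Finset.mul_sum, Finset.mul_sum, Finset.mul_sum]
    refine Finset.sum_congr rfl fun j _ => ?_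
    rw [← Polynomial.coe_aeval_eq_eval]
    have hP : Polynomial.aeval (x : ℂ) P = ((Polynomial.aeval x P : ℝ) : ℂ) := by
      rw [← Complex.coe_algebraMap, Polynomial.aeval_algebraMap_apply]
    rw [hP]
    -- With truncated subtraction this is equivalent to `m ≤ i + j`, even when `i > m`.
    by_cases h : m - i ≤ j
    · rw [if_pos (by omega), if_pos h]
      push_cast
      rw [pow_add, mul_pow]
      ring
    · rw [if_neg (by omega), if_neg h]
      simp
  · intro p _
    refine ContinuousOn.circleIntegrable (by norm_num) ?_
    refine ContinuousOn.mul continuousOn_const ?_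
    refine ContinuousOn.div (ContinuousOn.div (by fun_prop) (by fun_prop) fun u hu => ?_)
      (by fun_prop) fun u hu => sphere_sub_ne_zero hu hxn
    exact pow_ne_zero _ (sphere_sub_ne_zero hu (by norm_num))

/-- The correlation kernel as a real integral against binomial tails. -/
theorem kernelK_eq (b α : ℝ) (T : ℕ) (p p' : ℕ × ℕ) (hb : b = α + α ^ 2 / 2) :
    kernelK α T p p' = (((2 : ℝ) ^ (levelParam p.2 + 1 / 2) / Real.pi *
      ((if p'.2 ≤ p.2 then ∫ x in (-1 : ℝ)..1,
        (jacobi p.1 (levelParam p.2)).eval x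
          * (1 - x) ^ ((levelRank p.2 : ℝ) - levelRank p'.2 + levelParam p.2)
          * (1 + x) ^ (1 / 2 : ℝ) * (jacobi p'.1 (levelParam p'.2)).eval x else 0)
        - ∫ x in (-1 : ℝ)..1, (jacobi p.1 (levelParam p.2)).eval x
          * (1 - x) ^ ((levelRank p.2 : ℝ) - levelRank p'.2 + levelParam p.2)
          * (1 + x) ^ (1 / 2 : ℝ)
          * truncEval b T (levelRank p'.2)
            ((jacobi p'.1 (levelParam p'.2)).comp (1 - Polynomial.X)) x) : ℝ) : ℂ) := by
  have h1 : (∫ x in (-1 : ℝ)..1, ∮ u in C(0, 2),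
        phi α x ^ T / phi α u ^ T
          * Polynomial.aeval (x : ℂ) (jacobi p.1 (levelParam p.2))
          * Polynomial.aeval u (jacobi p'.1 (levelParam p'.2))
          * ((1 - (x : ℂ)) ^ levelRank p.2 / (1 - u) ^ levelRank p'.2)
          * ((((1 - x) ^ levelParam p.2 * (1 + x) ^ (1 / 2 : ℝ) : ℝ) : ℂ) / ((x : ℂ) - u)))
      = ∫ x in (-1 : ℝ)..1, -(2 * Real.pi * Complex.I) *
        (((jacobi p.1 (levelParam p.2)).eval x
          * (1 - x) ^ ((levelRank p.2 : ℝ) - levelRank p'.2 + levelParam p.2)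
          * (1 + x) ^ (1 / 2 : ℝ)
          * truncEval b T (levelRank p'.2)
            ((jacobi p'.1 (levelParam p'.2)).comp (1 - Polynomial.X)) x : ℝ) : ℂ) := by
    refine intervalIntegral.integral_congr_Ioo_of_le (by norm_num) fun x hx => ?_
    have h1x : 0 < 1 - x := by linarith [hx.2]
    rw [circleIntegral_kernel b T _ _ _ _ α _ x hb hx]
    congr 2
    rw [Real.rpow_add h1x, Real.rpow_sub h1x, Real.rpow_natCast, Real.rpow_natCast]
    ring
  have h2 : (2 * Real.pi * Complex.I : ℂ) ≠ 0 := Complex.two_pi_I_ne_zero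
  rw [kernelK, h1, intervalIntegral.integral_const_mul, intervalIntegral.integral_ofReal]
  have h3 : ∀ A B : ℂ, A * (1 / (2 * Real.pi * Complex.I)) * (-(2 * Real.pi * Complex.I) * B)
      = -(A * B) := by
    intro A B
    field_simp
  rw [h3]
  split_ifs
  · have h4 : ∀ x : ℝ, (jacobi p.1 (levelParam p.2)).eval x
          * (jacobi p'.1 (levelParam p'.2)).eval x
          * (1 - x) ^ ((levelRank p.2 : ℝ) - levelRank p'.2 + levelParam p.2)
          * (1 + x) ^ (1 / 2 : ℝ)
        = (jacobi p.1 (levelParam p.2)).eval x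
          * (1 - x) ^ ((levelRank p.2 : ℝ) - levelRank p'.2 + levelParam p.2)
          * (1 + x) ^ (1 / 2 : ℝ) * (jacobi p'.1 (levelParam p'.2)).eval x := fun x => by ring
    simp only [h4]
    push_cast
    ring
  · push_cast
    ring

/-! ### Passing to the limit under the integral. -/

theorem intervalIntegrable_one_sub_rpow {c : ℝ} (hc : -1 < c) (u v : ℝ) :
    IntervalIntegrable (fun x : ℝ => (1 - x) ^ c) MeasureTheory.volume u v := by
  have h := (intervalIntegral.intervalIntegrable_rpow' (a := 1 - u) (b := 1 - v) hc).comp_sub_left 1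
  simpa using h

theorem intervalIntegrable_weight {c : ℝ} (hc : -1 < c) (u v : ℝ) {f g : ℝ → ℝ}
    (hf : Continuous f) (hg : Continuous g) :
    IntervalIntegrable (fun x : ℝ => f x * (1 - x) ^ c * (1 + x) ^ (1 / 2 : ℝ) * g x)
      MeasureTheory.volume u v := by
  have h1 : Continuous fun x : ℝ => (1 + x) ^ (1 / 2 : ℝ) :=
    (continuous_const.add continuous_id).rpow_const fun x => Or.inr (by norm_num)
  have h2 := (intervalIntegrable_one_sub_rpow hc u v).continuousOn_mul
    (hf.mul (h1.mul hg)).continuousOn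
  refine h2.congr (fun x _ => ?_)
  simp only [Pi.mul_apply]
  ring

section Limits

variable {t l b : ℝ} {T m : ℕ → ℕ}

theorem tendsto_truncEval (P : Polynomial ℝ) (x χ : ℝ)
    (h : ∀ i, Filter.Tendsto (fun N => binomTail (T N) (m N - i) (b * (1 - x)))
      Filter.atTop (nhds χ)) :
    Filter.Tendsto (fun N => truncEval b (T N) (m N) (P.comp (1 - Polynomial.X)) x)
      Filter.atTop (nhds (χ * P.eval x)) := by
  rw [eval_comp_one_sub, mul_comm, Finset.sum_mul]
  exact tendsto_finsetSum _ fun i _ => (h i).const_mul _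

theorem exists_abs_truncEval_le (Q : Polynomial ℝ) (d : ℕ) (hl : 0 < l) (hb : 0 ≤ b)
    (hT : Filter.Tendsto (fun N : ℕ => (T N : ℝ) / N) Filter.atTop (nhds t))
    (hm : Filter.Tendsto (fun N : ℕ => (m N : ℝ) / N) Filter.atTop (nhds l)) :
    ∃ C : ℝ, 0 ≤ C ∧ ∀ᶠ N in Filter.atTop, ∀ x ∈ Set.Ioo (-1 : ℝ) 1,
      |truncEval b (T N) (m N) Q x| ≤ C * (1 - x) ^ d := by
  choose C hC0 hC using fun i : ℕ => exists_binomTail_le_pow d hl hT (tendsto_natSub_div i hm)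
  refine ⟨∑ i ∈ Finset.range (Q.natDegree + 1), |Q.coeff i| * 2 ^ i * (C i * b ^ d),
    Finset.sum_nonneg fun i _ => by have := hC0 i; positivity, ?_⟩
  filter_upwards [(Filter.eventually_all_finset (Finset.range (Q.natDegree + 1))).mpr
    fun i _ => hC i] with N hN x hx
  have hy : 0 ≤ 1 - x := by linarith [hx.2]
  have hy2 : 1 - x ≤ 2 := by linarith [hx.1]
  rw [truncEval, Finset.sum_mul]
  refine (Finset.abs_sum_le_sum_abs _ _).trans (Finset.sum_le_sum fun i hi => ?_)
  have h1 := hN i hi (b * (1 - x)) (mul_nonneg hb hy)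
  have h2 := binomTail_nonneg (T N) (m N - i) (mul_nonneg hb hy)
  rw [abs_mul, abs_mul, abs_pow, abs_of_nonneg hy, abs_of_nonneg h2, mul_assoc _ (C i * b ^ d),
    mul_assoc (C i), ← mul_pow]
  gcongr

theorem continuousOn_truncEval (T m : ℕ) (Q : Polynomial ℝ) (hb : 0 ≤ b) :
    ContinuousOn (truncEval b T m Q) (Set.Iic 1) := by
  unfold truncEval binomTail
  refine continuousOn_finsetSum _ fun i _ => ContinuousOn.mul (by fun_prop) ?_
  refine ContinuousOn.div (continuousOn_finsetSum _ fun j _ => ?_) (by fun_prop) fun x hx => ?_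
  · split_ifs <;> fun_prop
  · have : 0 ≤ b * (1 - x) := mul_nonneg hb (sub_nonneg.mpr hx)
    positivity

theorem tendsto_integral_truncEval (P P' : Polynomial ℝ) (e : ℤ) (a : ℝ) (ha : -1 < a)
    (χ : ℝ → ℝ) (hl : 0 < l) (hb : 0 ≤ b)
    (hT : Filter.Tendsto (fun N : ℕ => (T N : ℝ) / N) Filter.atTop (nhds t))
    (hm : Filter.Tendsto (fun N : ℕ => (m N : ℝ) / N) Filter.atTop (nhds l))
    (hχ : ∀ᵐ x : ℝ, x ∈ Set.Ioo (-1 : ℝ) 1 → ∀ i, Filter.Tendsto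
      (fun N => binomTail (T N) (m N - i) (b * (1 - x))) Filter.atTop (nhds (χ x))) :
    Filter.Tendsto (fun N => ∫ x in (-1 : ℝ)..1,
        P.eval x * (1 - x) ^ ((e : ℝ) + a) * (1 + x) ^ (1 / 2 : ℝ)
          * truncEval b (T N) (m N) (P'.comp (1 - Polynomial.X)) x)
      Filter.atTop (nhds (∫ x in (-1 : ℝ)..1,
        P.eval x * (1 - x) ^ ((e : ℝ) + a) * (1 + x) ^ (1 / 2 : ℝ) * (χ x * P'.eval x))) := by
  -- A zero of order `max (-e) 0` at `x = 1` offsets a negative `e`, leaving the integrable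
  -- singularity `(1 - x)^a`.
  obtain ⟨C, hC0, hC⟩ := exists_abs_truncEval_le (P'.comp (1 - Polynomial.X)) (-e).toNat hl hb hT hm
  have hne : ∀ᵐ x : ℝ, x ≠ 1 := MeasureTheory.Measure.ae_ne _ 1
  refine intervalIntegral.tendsto_integral_filter_of_dominated_convergence
    (fun x => |P.eval x| * (1 - x) ^ a * (1 + x) ^ (1 / 2 : ℝ) * (C * 2 ^ e.toNat)) ?_ ?_ ?_ ?_
  · refine Filter.Eventually.of_forall fun N => ?_
    refine MeasureTheory.AEStronglyMeasurable.mul ?_ ?_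
    · exact Measurable.aestronglyMeasurable (by fun_prop)
    · rw [Set.uIoc_of_le (by norm_num)]
      exact ((continuousOn_truncEval _ _ _ hb).mono fun x hx => hx.2).aestronglyMeasurable
        measurableSet_Ioc
  · filter_upwards [hC] with N hN
    filter_upwards [hne] with x hx1 hx
    rw [Set.uIoc_of_le (by norm_num)] at hx
    have hx' : x ∈ Set.Ioo (-1 : ℝ) 1 := ⟨hx.1, lt_of_le_of_ne hx.2 hx1⟩
    have hy : 0 < 1 - x := by linarith [hx'.2]
    have hz : 0 < 1 + x := by linarith [hx'.1]
    rw [norm_mul, norm_mul, norm_mul, Real.norm_eq_abs, Real.norm_eq_abs, Real.norm_eq_abs,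
      Real.norm_eq_abs, abs_of_nonneg (Real.rpow_nonneg hy.le _),
      abs_of_nonneg (Real.rpow_nonneg hz.le _)]
    have h1 : (1 - x) ^ ((e : ℝ) + a) * (1 - x) ^ (-e).toNat
        = (1 - x) ^ e.toNat * (1 - x) ^ a := by
      rw [← Real.rpow_natCast, ← Real.rpow_natCast, ← Real.rpow_add hy, ← Real.rpow_add hy]
      congr 1
      have : (e : ℝ) + ((-e).toNat : ℝ) = (e.toNat : ℝ) := by
        exact_mod_cast (by omega : e + ((-e).toNat : ℤ) = (e.toNat : ℤ))
      linarith
    have h2 : (1 - x) ^ e.toNat ≤ 2 ^ e.toNat := pow_le_pow_left₀ hy.le (by linarith [hx'.1]) _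
    calc _ ≤ |P.eval x| * (1 - x) ^ ((e : ℝ) + a) * (1 + x) ^ (1 / 2 : ℝ)
            * (C * (1 - x) ^ (-e).toNat) := by gcongr; exact hN x hx'
      _ = |P.eval x| * (1 + x) ^ (1 / 2 : ℝ) * C
            * ((1 - x) ^ ((e : ℝ) + a) * (1 - x) ^ (-e).toNat) := by ring
      _ = |P.eval x| * (1 + x) ^ (1 / 2 : ℝ) * C * ((1 - x) ^ e.toNat * (1 - x) ^ a) := by rw [h1]
      _ ≤ |P.eval x| * (1 + x) ^ (1 / 2 : ℝ) * C * (2 ^ e.toNat * (1 - x) ^ a) := by gcongr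
      _ = _ := by ring
  · exact intervalIntegrable_weight ha _ _ (by fun_prop) (by fun_prop)
  · filter_upwards [hne, hχ] with x hx1 h hx
    rw [Set.uIoc_of_le (by norm_num)] at hx
    exact (tendsto_truncEval P' x _ (h ⟨hx.1, lt_of_le_of_ne hx.2 hx1⟩)).const_mul _

end Limits

/-! ### The limiting kernel. -/

/-- The entries of the limiting matrix in terms of the limit `χ` of the binomial tails. -/
noncomputable def limitKernel (χ : ℝ → ℝ) (e : ℤ) (a : ℝ) (s : ℕ) (a' : ℝ) (s' : ℕ) : ℝ :=
  (2 : ℝ) ^ (a + 1 / 2) / Real.pi *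
    ((if 0 ≤ 2 * (e : ℝ) + a - a' then ∫ x in (-1 : ℝ)..1,
        (jacobi s a).eval x * (1 - x) ^ ((e : ℝ) + a) * (1 + x) ^ (1 / 2 : ℝ) * (jacobi s' a').eval x
      else 0)
      - ∫ x in (-1 : ℝ)..1,
        (jacobi s a).eval x * (1 - x) ^ ((e : ℝ) + a) * (1 + x) ^ (1 / 2 : ℝ)
          * (χ x * (jacobi s' a').eval x))

theorem levelParam_levelRank_eq {k r : ℕ} {a : ℝ} (ha : a = 1 / 2 ∨ a = -(1 / 2))
    (hk : (k : ℝ) = 2 * r + a - 1 / 2) : levelParam k = a ∧ levelRank k = r := by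
  rcases ha with rfl | rfl
  · have h : k = 2 * r := by
      have : (k : ℝ) = ((2 * r : ℕ) : ℝ) := by push_cast; linarith
      exact_mod_cast this
    subst h
    refine ⟨if_neg (by simp), ?_⟩
    unfold levelRank
    omega
  · have h : k + 1 = 2 * r := by
      have : ((k + 1 : ℕ) : ℝ) = ((2 * r : ℕ) : ℝ) := by push_cast; linarith
      exact_mod_cast this
    refine ⟨if_pos ⟨r - 1, by omega⟩, ?_⟩
    unfold levelRank
    omega

theorem tendsto_kernelK {t l b α : ℝ} {T k r k' r' : ℕ → ℕ} {s s' : ℕ} {a a' : ℝ}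
    (hb : b = α + α ^ 2 / 2) (hb0 : 0 ≤ b) (hl : 0 < l)
    (ha : a = 1 / 2 ∨ a = -(1 / 2)) (ha' : a' = 1 / 2 ∨ a' = -(1 / 2))
    (hT : Filter.Tendsto (fun N : ℕ => (T N : ℝ) / N) Filter.atTop (nhds t))
    (hr' : Filter.Tendsto (fun N : ℕ => (r' N : ℝ) / N) Filter.atTop (nhds l))
    (hk : ∀ N, (k N : ℝ) = 2 * r N + a - 1 / 2) (hk' : ∀ N, (k' N : ℝ) = 2 * r' N + a' - 1 / 2)
    (e : ℤ) (he : ∀ N, (r N : ℤ) - r' N = e) (χ : ℝ → ℝ)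
    (hχ : ∀ᵐ x : ℝ, x ∈ Set.Ioo (-1 : ℝ) 1 → ∀ m : ℕ → ℕ,
      Filter.Tendsto (fun N : ℕ => (m N : ℝ) / N) Filter.atTop (nhds l) →
      Filter.Tendsto (fun N => binomTail (T N) (m N) (b * (1 - x))) Filter.atTop (nhds (χ x))) :
    Filter.Tendsto (fun N => kernelK α (T N) (s, k N) (s', k' N)) Filter.atTop
      (nhds ((limitKernel χ e a s a' s' : ℝ) : ℂ)) := by
  have ha1 : -1 < a := by rcases ha with rfl | rfl <;> norm_num
  have he' : ∀ N, (r N : ℝ) - r' N = e := fun N => by exact_mod_cast he N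
  -- The order of the two levels depends only on `e`, `a`, `a'`, so the same branch applies for
  -- every `N`.
  have hcond : ∀ N, k' N ≤ k N ↔ 0 ≤ 2 * (e : ℝ) + a - a' := by
    intro N
    rw [← Nat.cast_le (α := ℝ), hk, hk', ← he' N]
    constructor <;> intro h <;> linarith
  have hlim := tendsto_integral_truncEval (jacobi s a) (jacobi s' a') e a ha1 χ hl hb0 hT hr'
    (by
      filter_upwards [hχ] with x h hx i
      exact h hx _ (tendsto_natSub_div i hr'))
  have hK : ∀ N, kernelK α (T N) (s, k N) (s', k' N) = _ := fun N => kernelK_eq b α _ _ _ hb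
  simp only [(levelParam_levelRank_eq ha (hk _)).1, (levelParam_levelRank_eq ha (hk _)).2,
    (levelParam_levelRank_eq ha' (hk' _)).1, (levelParam_levelRank_eq ha' (hk' _)).2,
    he', hcond] at hK
  simp only [hK]
  exact (Complex.continuous_ofReal.tendsto _).comp ((hlim.const_sub _).const_mul _)

theorem limitKernel_zero_of_neg {e : ℤ} {a a' : ℝ} (s s' : ℕ) (h : 2 * (e : ℝ) + a - a' < 0) :
    limitKernel 0 e a s a' s' = 0 := by
  simp [limitKernel, not_le.mpr h]

theorem limitKernel_zero_same_level {a : ℝ} (ha : a = 1 / 2 ∨ a = -(1 / 2)) (s s' : ℕ) :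
    limitKernel 0 0 a s a s' = if s = s' then 1 else 0 := by
  rw [← integral_jacobi_mul_jacobi s s' a ha]
  simp only [limitKernel, Int.cast_zero, zero_add, mul_zero, sub_self, le_refl, if_true,
    Pi.zero_apply, zero_mul, intervalIntegral.integral_zero, sub_zero]
  congr 1
  refine intervalIntegral.integral_congr fun x _ => ?_
  ring

theorem sub_one_zpow_mul {x : ℝ} (hx : x < 1) (e : ℤ) (a : ℝ) :
    (x - 1) ^ e * (1 - x) ^ a = (-1) ^ e * (1 - x) ^ ((e : ℝ) + a) := by
  have h : 0 < 1 - x := by linarith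
  rw [Real.rpow_add h, Real.rpow_intCast, show x - 1 = -1 * (1 - x) by ring, mul_zpow, mul_assoc]

/-- The indicator cuts the subtracted integral to `(-1, θ)`: the full integral, when present, leaves
`(θ, 1)`, and otherwise `-∫` over `(-1, θ)` remains. The sign comes from `(x - 1)^e` versus `(1 -
x)^e`. -/
theorem limitKernel_indicator {θ : ℝ} (hθ : θ ∈ Set.Ioo (-1 : ℝ) 1) (r r' : ℤ) {a a' : ℝ}
    (ha : a = 1 / 2 ∨ a = -(1 / 2)) (ha' : a' = 1 / 2 ∨ a' = -(1 / 2)) (s s' : ℕ) :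
    limitKernel (fun x => if x < θ then 1 else 0) (r - r') a s a' s'
      = (-1) ^ (r - r') * kernelL r a s r' a' s' (1 / 2) θ := by
  have hsign : ((-1 : ℝ) ^ (r - r')) * (-1) ^ (r - r') = 1 := by
    rw [← mul_zpow]; norm_num
  set f : ℝ → ℝ := fun x => (jacobi s a).eval x * (1 - x) ^ (((r - r' : ℤ) : ℝ) + a)
    * (1 + x) ^ (1 / 2 : ℝ) * (jacobi s' a').eval x with hf
  have hL : ∀ u v : ℝ, u ≤ v → v ≤ 1 → ∫ x in u..v, (jacobi s a).eval x * (jacobi s' a').eval x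
        * (x - 1) ^ (r - r') * (1 - x) ^ a * (1 + x) ^ (1 / 2 : ℝ)
      = (-1) ^ (r - r') * ∫ x in u..v, f x := by
    intro u v huv hv
    rw [← intervalIntegral.integral_const_mul]
    refine intervalIntegral.integral_congr_Ioo_of_le huv fun x hx => ?_
    have h := sub_one_zpow_mul (hx.2.trans_le hv) (r - r') a
    simp only [hf]
    linear_combination ((jacobi s a).eval x * (jacobi s' a').eval x * (1 + x) ^ (1 / 2 : ℝ)) * h
  set g : ℝ → ℝ := fun x => (jacobi s a).eval x * (1 - x) ^ (((r - r' : ℤ) : ℝ) + a)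
    * (1 + x) ^ (1 / 2 : ℝ) * ((if x < θ then 1 else 0) * (jacobi s' a').eval x) with hg
  have hfl : IntervalIntegrable f MeasureTheory.volume (-1) θ := by
    refine ContinuousOn.intervalIntegrable ?_
    rw [Set.uIcc_of_le hθ.1.le]
    refine ContinuousOn.mul (ContinuousOn.mul (ContinuousOn.mul (by fun_prop) ?_) ?_) (by fun_prop)
    · refine ContinuousOn.rpow_const (by fun_prop) fun x hx => Or.inl ?_
      have := hx.2
      have := hθ.2
      exact (by linarith : 0 < 1 - x).ne'
    · exact ContinuousOn.rpow_const (by fun_prop) fun x hx => Or.inr (by norm_num)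
  have hgf : Set.EqOn f g (Set.Ioo (-1) θ) := fun x hx => by simp [hf, hg, hx.2]
  have hg0 : Set.EqOn (fun _ => 0) g (Set.uIoc θ 1) := fun x hx => by
    rw [Set.uIoc_of_le hθ.2.le] at hx
    simp [hg, hx.1.le]
  have hgl : IntervalIntegrable g MeasureTheory.volume (-1) θ := by
    refine hfl.congr_ae ?_
    rw [Filter.EventuallyEq, MeasureTheory.ae_restrict_iff' measurableSet_uIoc,
      Set.uIoc_of_le hθ.1.le]
    filter_upwards [MeasureTheory.Measure.ae_ne MeasureTheory.volume θ] with x hx h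
    exact hgf ⟨h.1, lt_of_le_of_ne h.2 hx⟩
  have hgr : IntervalIntegrable g MeasureTheory.volume θ 1 :=
    (intervalIntegrable_const (c := (0 : ℝ))).congr hg0
  have hgint : ∫ x in (-1 : ℝ)..1, g x = ∫ x in (-1 : ℝ)..θ, f x := by
    rw [← intervalIntegral.integral_add_adjacent_intervals hgl hgr,
      intervalIntegral.integral_congr_Ioo_of_le hθ.1.le hgf,
      ← intervalIntegral.integral_congr_uIoo
        (fun x hx => hg0 ⟨hx.1, hx.2.le⟩)]
    simp
  have hcond : 2 * (r : ℝ) + a ≥ 2 * (r' : ℝ) + a' ↔ 0 ≤ 2 * (((r - r' : ℤ) : ℝ)) + a - a' := by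
    push_cast
    constructor <;> intro h <;> linarith
  rw [limitKernel, kernelL]
  simp only [hcond]
  split_ifs with h
  -- Since `|a - a'| ≤ 1`, the level condition forces the integer `r - r'` to be nonnegative, so the
  -- weight is integrable up to `1` and the integral may be split at `θ`.
  · have he : 0 ≤ r - r' := by
      by_contra hlt
      have h1 : ((r - r' : ℤ) : ℝ) ≤ -1 := by exact_mod_cast (by omega : r - r' ≤ -1)
      rcases ha with rfl | rfl <;> rcases ha' with rfl | rfl <;> linarith
    have he' : (0 : ℝ) ≤ ((r - r' : ℤ) : ℝ) := by exact_mod_cast he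
    have hexp : -1 < ((r - r' : ℤ) : ℝ) + a := by
      rcases ha with rfl | rfl <;> linarith
    have hfr : IntervalIntegrable f MeasureTheory.volume θ 1 :=
      intervalIntegrable_weight hexp _ _ (by fun_prop) (by fun_prop)
    rw [hL θ 1 hθ.2.le le_rfl, hgint]
    change _ * ((∫ x in (-1 : ℝ)..1, f x) - _) = _
    rw [← intervalIntegral.integral_add_adjacent_intervals hfl hfr]
    linear_combination (-((2 : ℝ) ^ (a + 1 / 2) / Real.pi) * ∫ x in θ..1, f x) * hsign
  · rw [hL (-1) θ hθ.1.le hθ.2.le, hgint]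
    linear_combination ((2 : ℝ) ^ (a + 1 / 2) / Real.pi * ∫ x in (-1 : ℝ)..θ, f x) * hsign

/-! ### Determinants. -/

/-- A block triangular matrix with identity diagonal blocks has determinant one. -/
theorem det_eq_one_of_blockTriangular {n : ℕ} (M : Fin n → Fin n → ℝ) (k : Fin n → ℕ)
    (h0 : ∀ i j, k i < k j → M i j = 0)
    (h1 : ∀ i j, k i = k j → M i j = if i = j then 1 else 0) :
    (Matrix.of fun i j => M i j).det = 1 := by
  rw [← Matrix.det_transpose]
  have hM : (Matrix.of fun i j => M i j).transpose.BlockTriangular k := fun i j hij => h0 j i hij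
  rw [hM.det]
  refine Finset.prod_eq_one fun c _ => ?_
  have : (Matrix.of fun i j => M i j).transpose.toSquareBlock k c = 1 := by
    ext i j
    rw [Matrix.toSquareBlock_def, Matrix.of_apply, Matrix.transpose_apply,
      Matrix.of_apply, h1 _ _ (j.2.trans i.2.symm), Matrix.one_apply]
    simp only [Subtype.ext_iff, eq_comm]
  rw [this, Matrix.det_one]

/-- The signs amount to conjugation by a diagonal matrix that is its own inverse. -/
theorem det_mul_zpow_sub {n : ℕ} (M : Matrix (Fin n) (Fin n) ℝ) (r : Fin n → ℤ) :
    (Matrix.of fun i j => (-1 : ℝ) ^ (r i - r j) * M i j).det = M.det := by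
  have h : (Matrix.of fun i j => (-1 : ℝ) ^ (r i - r j) * M i j)
      = Matrix.diagonal (fun i => (-1 : ℝ) ^ r i) * M * Matrix.diagonal (fun i => (-1 : ℝ) ^ r i) := by
    ext i j
    rw [Matrix.mul_diagonal, Matrix.diagonal_mul, Matrix.of_apply, zpow_sub₀ (by norm_num),
      div_eq_mul_inv, ← inv_zpow]
    norm_num
    ring
  rw [h, Matrix.det_mul, Matrix.det_mul, Matrix.det_diagonal, mul_right_comm,
    ← Finset.prod_mul_distrib]
  simp only [← mul_zpow]
  norm_num

theorem tendsto_det_ofReal {n : ℕ} {K : ℕ → Fin n → Fin n → ℂ} {M : Fin n → Fin n → ℝ}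
    (h : ∀ i j, Filter.Tendsto (fun N => K N i j) Filter.atTop (nhds (M i j : ℂ))) :
    Filter.Tendsto (fun N => (Matrix.of fun i j => K N i j).det) Filter.atTop
      (nhds (((Matrix.of fun i j => M i j).det : ℝ) : ℂ)) := by
  have h1 : (((Matrix.of fun i j => M i j).det : ℝ) : ℂ)
      = (Matrix.of fun i j => ((M i j : ℝ) : ℂ)).det :=
    RingHom.map_det Complex.ofRealHom _
  rw [h1]
  refine ((Continuous.matrix_det continuous_id).tendsto
    (Matrix.of fun i j => ((M i j : ℝ) : ℂ))).comp ?_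
  exact tendsto_pi_nhds.mpr fun i => tendsto_pi_nhds.mpr fun j => h i j

end DiscreteJacobi

/-! ### The two regimes. -/

theorem mainTheorem4
    (q α t l θ : ℝ) (hq₀ : 0 ≤ q) (hq₁ : q < 1) (hα : α = 2 * q / (1 - q))
    (ht : 0 < t) (hl : 0 < l)
    (hθ : θ = 1 + 2 * l / ((l - t) * (2 * α + α ^ 2)))
    (n : ℕ) (s : Fin n → ℕ) (a : Fin n → ℝ) (ha : ∀ i, a i = 1 / 2 ∨ a i = -(1 / 2))
    (T : ℕ → ℕ) (r k : Fin n → ℕ → ℕ)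
    (hT : Filter.Tendsto (fun N : ℕ => (T N : ℝ) / N) Filter.atTop (nhds t))
    (hr : ∀ i, Filter.Tendsto (fun N : ℕ => (r i N : ℝ) / N) Filter.atTop (nhds l))
    (hdiff : ∀ i j N M, (r i N : ℤ) - r j N = (r i M : ℤ) - r j M)
    (hk : ∀ i N, (k i N : ℝ) = 2 * r i N + a i - 1 / 2) :
    ((1 - ((1 + α) ^ 2)⁻¹) * t ≤ l →
      (∀ N, Function.Injective fun i => (s i, k i N)) →
      Filter.Tendsto
        (fun N : ℕ => Matrix.det (Matrix.of fun i j : Fin n =>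
          DiscreteJacobi.kernelK α (T N) (s i, k i N) (s j, k j N)))
        Filter.atTop (nhds 1)) ∧
    (l < (1 - ((1 + α) ^ 2)⁻¹) * t →
      ∀ M : ℕ, Filter.Tendsto
        (fun N : ℕ => Matrix.det (Matrix.of fun i j : Fin n =>
          DiscreteJacobi.kernelK α (T N) (s i, k i N) (s j, k j N)))
        Filter.atTop
        (nhds ((Matrix.det (Matrix.of fun i j : Fin n =>
          DiscreteJacobi.kernelL (r i M) (a i) (s i) (r j M) (a j) (s j) (1 / 2) θ) : ℝ) : ℂ))) := by
  set b : ℝ := α + α ^ 2 / 2 with hb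
  have hα0 : 0 ≤ α := by
    rw [hα]
    exact div_nonneg (by linarith) (by linarith)
  have hb0 : 0 ≤ b := by positivity
  have h1b : (1 + α) ^ 2 = 1 + 2 * b := by rw [hb]; ring
  have hthr : (1 - ((1 + α) ^ 2)⁻¹) * t = 2 * b * t / (1 + 2 * b) := by
    rw [h1b]
    field_simp
    ring
  have hdiff' : ∀ i j N, (r i N : ℤ) - r j N = (r i 0 : ℤ) - r j 0 := fun i j N => hdiff i j N 0
  rw [hthr]
  constructor
  · intro h hinj
    rw [div_le_iff₀ (by linarith)] at h
    have hχ : ∀ᵐ x : ℝ, x ∈ Set.Ioo (-1 : ℝ) 1 → ∀ m : ℕ → ℕ,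
        Filter.Tendsto (fun N : ℕ => (m N : ℝ) / N) Filter.atTop (nhds l) →
        Filter.Tendsto (fun N => DiscreteJacobi.binomTail (T N) (m N) (b * (1 - x)))
          Filter.atTop (nhds ((0 : ℝ → ℝ) x)) := by
      refine Filter.Eventually.of_forall fun x hx m hm => ?_
      have hy : 0 < 1 - x := by linarith [hx.2]
      have hy2 : 1 - x < 2 := by linarith [hx.1]
      have hz : 0 ≤ b * (1 - x) := by positivity
      refine DiscreteJacobi.tendsto_binomTail_zero hz ?_ hT hm
      rw [← mul_div_assoc, div_lt_iff₀ (by linarith)]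
      have h1 := mul_le_mul_of_nonneg_right h hy.le
      -- Strictness comes from `x > -1`: the threshold on `l` is the mean at `x = -1`, so equality
      -- is allowed.
      have h2 := mul_lt_mul_of_pos_left hy2 hl
      linarith
    have hlim := DiscreteJacobi.tendsto_det_ofReal fun i j =>
      DiscreteJacobi.tendsto_kernelK (s := s i) (s' := s j) hb hb0 hl (ha i) (ha j) hT (hr j)
        (hk i) (hk j) _ (hdiff' i j) 0 hχ
    -- The levels at `N = 0` serve as block labels, because the limit entries depend only on
    -- differences of ranks.
    rw [DiscreteJacobi.det_eq_one_of_blockTriangular _ (fun i => k i 0)] at hlim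
    · simpa using hlim
    · intro i j hij
      refine DiscreteJacobi.limitKernel_zero_of_neg _ _ ?_
      have h1 : (k i 0 : ℝ) < k j 0 := by exact_mod_cast hij
      rw [hk, hk] at h1
      push_cast
      linarith
    · intro i j hij
      have h1 := DiscreteJacobi.levelParam_levelRank_eq (ha i) (hk i 0)
      have h2 := DiscreteJacobi.levelParam_levelRank_eq (ha j) (hk j 0)
      rw [hij] at h1
      rw [← h1.1, ← h1.2, ← h2.1, ← h2.2, sub_self,
        DiscreteJacobi.limitKernel_zero_same_level (h1.1 ▸ ha i)]
      refine if_congr ⟨fun h => hinj 0 (Prod.ext h hij), fun h => h ▸ rfl⟩ rfl rfl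
  · intro h M
    rw [lt_div_iff₀ (by linarith)] at h
    -- If `b = 0` the threshold is zero, contradicting `l > 0`.
    have hb1 : 0 < b := by
      refine lt_of_le_of_ne hb0 fun h0 => ?_
      rw [← h0] at h
      linarith
    have hlt : 0 < t - l := by
      have : 0 < 2 * b * (t - l) := by linarith
      exact pos_of_mul_pos_right this (by positivity)
    -- This is the solution of `t z / (1 + z) = l` for `z = b (1 - θ)`.
    have hθ' : 1 - θ = l / (b * (t - l)) := by
      have h1 : l - t ≠ 0 := by linarith
      have h2 : t - l ≠ 0 := hlt.ne'
      rw [hθ, show 2 * α + α ^ 2 = 2 * b by rw [hb]; ring, ← neg_sub t l]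
      field_simp
      ring
    have hθm : (1 - θ) * (b * (t - l)) = l := by
      rw [hθ', div_mul_cancel₀ _ (by positivity)]
    have hθI : θ ∈ Set.Ioo (-1 : ℝ) 1 := by
      constructor
      · have : 1 - θ < 2 := by
          rw [hθ', div_lt_iff₀ (by positivity)]
          linarith
        linarith
      · have : 0 < 1 - θ := by rw [hθ']; positivity
        linarith
    have hχ : ∀ᵐ x : ℝ, x ∈ Set.Ioo (-1 : ℝ) 1 → ∀ m : ℕ → ℕ,
        Filter.Tendsto (fun N : ℕ => (m N : ℝ) / N) Filter.atTop (nhds l) →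
        Filter.Tendsto (fun N => DiscreteJacobi.binomTail (T N) (m N) (b * (1 - x)))
          Filter.atTop (nhds (if x < θ then 1 else 0)) := by
      -- At `x = θ` the mean matches the cutoff to leading order and Chebyshev gives nothing; this
      -- null set is discarded.
      filter_upwards [MeasureTheory.Measure.ae_ne MeasureTheory.volume θ] with x hxθ hx m hm
      have hy : 0 < 1 - x := by linarith [hx.2]
      have hz : 0 ≤ b * (1 - x) := by positivity
      have hbt : 0 < b * (t - l) := by positivity
      split_ifs with hlt'
      · refine DiscreteJacobi.tendsto_binomTail_one hz ?_ hT hm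
        rw [← mul_div_assoc, lt_div_iff₀ (by linarith)]
        have := mul_lt_mul_of_pos_right (by linarith : 1 - θ < 1 - x) hbt
        linarith
      · refine DiscreteJacobi.tendsto_binomTail_zero hz ?_ hT hm
        rw [← mul_div_assoc, div_lt_iff₀ (by linarith)]
        have hgt : θ < x := lt_of_le_of_ne (not_lt.mp hlt') hxθ.symm
        have := mul_lt_mul_of_pos_right (by linarith : 1 - x < 1 - θ) hbt
        linarith
    have hlim := DiscreteJacobi.tendsto_det_ofReal fun i j =>
      DiscreteJacobi.tendsto_kernelK (s := s i) (s' := s j) hb hb0 hl (ha i) (ha j) hT (hr j)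
        (hk i) (hk j) _ (fun N => hdiff i j N M) (fun x => if x < θ then 1 else 0) hχ
    simp only [DiscreteJacobi.limitKernel_indicator hθI _ _ (ha _) (ha _)] at hlim
    have hdet := DiscreteJacobi.det_mul_zpow_sub (Matrix.of fun i j : Fin n =>
      DiscreteJacobi.kernelL (r i M) (a i) (s i) (r j M) (a j) (s j) (1 / 2) θ)
      (fun i => (r i M : ℤ))
    simp only [Matrix.of_apply] at hdet
    rwa [hdet] at hlim
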